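/- Let $\Sigma$ be a finite alphabet and let $(\Sigma,T)$ be a rewriting system with a finite set of rules $T\subseteq\Sigma^*\times\Sigma^*$ that is length-reducing ($|\ell|>|r|$ for all $(\ell,r)\in T$), convergent (terminating and confluent) and inverse-closed (for every $a\in\Sigma$ there is $b\in\Sigma$ such that $ab$ rewrites in finitely many steps to the empty word). Let $G$ be the group presented by $(\Sigma,T)$, that is, the quotient of $\Sigma^*$ by the reflexive, symmetric and transitive closure of the one-step rewriting relation (it is a group since $\Sigma$ is inverse-closed). Let $|t|_{G,\Sigma}$ denote the length of a shortest word over $\Sigma\cup\Sigma^{-1}$ with value $t\in G$, and let ${\mathcal r}_T=\max\{|r| : (\ell,r)\in T\}$ (with ${\mathcal r}_T=0$ if $T=\emptyset$). Let $k\in\mathbb N$ and let $g,h\in G$ be non-trivial elements with $|g|_{G,\Sigma}\le k$ and $|h|_{G,\Sigma}\le k$ that are conjugate in $G$. Then: (a) If $g$ (equivalently, its conjugate $h$) has finite order, then every $t\in G$ with $tgt^{-1}=h$ satisfies $|t|_{G,\Sigma}\le 3{\mathcal r}_T+2k$. (b) The following are equivalent: 1. there exists $t\in G$ such that $tgt^{-1}=h$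 and $|t|_{G,\Sigma}>3{\mathcal r}_T+2k$; 2. $g$ has infinite order; 3. the centralizer $C_G(g)$ is isomorphic to $\mathbb Z$; 4. $C_G(g)$ is infinite. -/

import Mathlib

namespace Rewriting

/-- One rewriting step `x ℓ y → x r y` with `(ℓ, r) ∈ T`. Words over the alphabet `α` are the
elements of `FreeMonoid α`, and the empty word is `1`. -/
def Step {α : Type*} (T : Finset (FreeMonoid α × FreeMonoid α)) (u v : FreeMonoid α) : Prop :=
  ∃ x l r y : FreeMonoid α, (l, r) ∈ T ∧ u = x * l * y ∧ v = x * r * y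

/-- The reflexive transitive closure of one-step rewriting. -/
def Reduces {α : Type*} (T : Finset (FreeMonoid α × FreeMonoid α)) :
    FreeMonoid α → FreeMonoid α → Prop :=
  Relation.ReflTransGen (Step T)

/-- Every rule strictly decreases length. -/
def IsLengthReducing {α : Type*} (T : Finset (FreeMonoid α × FreeMonoid α)) : Prop :=
  ∀ p ∈ T, p.2.length < p.1.length

/-- There is no infinite sequence of rewriting steps. -/
def IsTerminating {α : Type*} (T : Finset (FreeMonoid α × FreeMonoid α)) : Prop :=
  ¬ ∃ f : ℕ → FreeMonoid α, ∀ n, Step T (f n) (f (n + 1))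

/-- Any two descendants of a word have a common descendant. -/
def IsConfluent {α : Type*} (T : Finset (FreeMonoid α × FreeMonoid α)) : Prop :=
  ∀ w x y : FreeMonoid α, Reduces T w x → Reduces T w y → ∃ z, Reduces T x z ∧ Reduces T y z

/-- Terminating and confluent. -/
def IsConvergent {α : Type*} (T : Finset (FreeMonoid α × FreeMonoid α)) : Prop :=
  IsTerminating T ∧ IsConfluent T

/-- For every letter `a` there is a letter `b` such that `ab` reduces to the empty word. -/
def IsInverseClosed {α : Type*} (T : Finset (FreeMonoid α × FreeMonoid α)) : Prop :=
  ∀ a : α, ∃ b : α, Reduces T (FreeMonoid.of a * FreeMonoid.of b) 1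

/-- The maximal length of a right-hand side of a rule. -/
def maxRhs {α : Type*} (T : Finset (FreeMonoid α × FreeMonoid α)) : ℕ :=
  T.sup fun p => p.2.length

theorem Step.mul_left {α : Type*} {T : Finset (FreeMonoid α × FreeMonoid α)}
    {u v : FreeMonoid α} (w : FreeMonoid α) (h : Step T u v) : Step T (w * u) (w * v) := by
  obtain ⟨x, l, r, y, hT, rfl, rfl⟩ := h
  exact ⟨w * x, l, r, y, hT, by simp only [mul_assoc], by simp only [mul_assoc]⟩

theorem Step.mul_right {α : Type*} {T : Finset (FreeMonoid α × FreeMonoid α)}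
    {u v : FreeMonoid α} (w : FreeMonoid α) (h : Step T u v) : Step T (u * w) (v * w) := by
  obtain ⟨x, l, r, y, hT, rfl, rfl⟩ := h
  exact ⟨x, l, r, y * w, hT, by simp only [mul_assoc], by simp only [mul_assoc]⟩

/-- The reflexive, symmetric and transitive closure of one-step rewriting, which is a
congruence on the free monoid. -/
def thueCon {α : Type*} (T : Finset (FreeMonoid α × FreeMonoid α)) : Con (FreeMonoid α) where
  r := Relation.EqvGen (Step T)
  iseqv := Relation.EqvGen.is_equivalence _
  mul' := by
    have hl : ∀ (w : FreeMonoid α) {u v : FreeMonoid α}, Relation.EqvGen (Step T) u v →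
        Relation.EqvGen (Step T) (w * u) (w * v) := by
      intro w u v h
      induction h with
      | rel _ _ h => exact .rel _ _ (h.mul_left w)
      | refl _ => exact .refl _
      | symm _ _ _ ih => exact .symm _ _ ih
      | trans _ _ _ _ _ ih₁ ih₂ => exact .trans _ _ _ ih₁ ih₂
    have hr : ∀ (w : FreeMonoid α) {u v : FreeMonoid α}, Relation.EqvGen (Step T) u v →
        Relation.EqvGen (Step T) (u * w) (v * w) := by
      intro w u v h
      induction h with
      | rel _ _ h => exact .rel _ _ (h.mul_right w)
      | refl _ => exact .refl _
      | symm _ _ _ ih => exact .symm _ _ ih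
      | trans _ _ _ _ _ ih₁ ih₂ => exact .trans _ _ _ ih₁ ih₂
    intro w x y z h₁ h₂
    exact .trans _ _ _ (hr y h₁) (hl x h₂)

/-- The monoid presented by the rewriting system with rules `T`. -/
abbrev PresentedBy {α : Type*} (T : Finset (FreeMonoid α × FreeMonoid α)) : Type _ :=
  (thueCon T).Quotient

/-- The elements of `G` spelled by the letters, when `G` is identified through `e` with the monoid
presented by `T`. -/
def letters {α G : Type*} [Group G] {T : Finset (FreeMonoid α × FreeMonoid α)}
    (e : PresentedBy T ≃* G) : Set G :=
  Set.range fun a : α => e ((thueCon T).mk' (FreeMonoid.of a))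

/-- `Spells S n g`: some word of length `n` in the elements of `S` and their inverses has
value `g`. -/
def Spells {G : Type*} [Group G] (S : Set G) (n : ℕ) (g : G) : Prop :=
  ∃ w : List G, (∀ x ∈ w, x ∈ S ∨ x⁻¹ ∈ S) ∧ w.length = n ∧ w.prod = g

/-- The word length of `g` with respect to the generating set `S`. -/
noncomputable def wordLength {G : Type*} [Group G] (S : Set G) (g : G) : ℕ :=
  sInf {n | Spells S n g}

/-- The ball of radius `k` about the identity. -/
def ball {G : Type*} [Group G] (S : Set G) (k : ℕ) : Set G :=
  {g | ∃ n ≤ k, Spells S n g}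

/-- The letters generate, so that the infimum defining `wordLength (letters e) g` is attained. -/
theorem exists_spells {α G : Type*} [Group G] {T : Finset (FreeMonoid α × FreeMonoid α)}
    (e : PresentedBy T ≃* G) (g : G) : ∃ n, Spells (letters e) n g := by
  obtain ⟨m, rfl⟩ := e.surjective g
  obtain ⟨w, rfl⟩ := Con.mk'_surjective m
  induction w using FreeMonoid.recOn with
  | one => exact ⟨0, [], by simp, rfl, by simp⟩
  | of_mul a w ih =>
    obtain ⟨n, l, h₁, h₂, h₃⟩ := ih
    refine ⟨n + 1, e ((thueCon T).mk' (FreeMonoid.of a)) :: l, ?_, by simp [h₂], by simp [h₃]⟩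
    intro x hx
    rcases List.mem_cons.1 hx with rfl | hx
    · exact Or.inl ⟨a, rfl⟩
    · exact h₁ x hx

end Rewriting

/-! Rules shorten words, so geodesic words are irreducible, and by confluence irreducible words with
the same value coincide. Hence geodesics in the Cayley graph are unique, and geodesics to adjacent
vertices at equal distance from `1` differ only in their last `maxRhs T` edges. `IsGeodetic` records
this; the geometry uses nothing else about `T`.

If `t * g = h * t` with `t` long, the geodesics from `1` to `t` and from `h` to `h * t` both follow,
in their middle part, the geodesic from `1` to `h * t` (`exists_overlap`). So `h` slides a stretch
of the geodesic to `t` along itself, by a nonzero amount since `h ≠ 1`. The translates of this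
stretch by powers of `h` form a locally geodesic line, which is globally geodesic
(`wordLength_eq_of_local`). This axis forces `h` to have infinite order. Whatever commutes with `h`
translates the axis (`exists_translate`), and left multiplication is free, so the centralizer embeds
in `ℤ`.

Finiteness of balls does the rest: infinite order gives long powers of `g`, and an infinite
centralizer gives long conjugators. -/

namespace Rewriting

/-! ### Geodesics in geodetic groups and the overlap of translated geodesics. -/

section WordLength

variable {G : Type*} [Group G] {S : Set G}

theorem wordLength_le {n : ℕ} {x : G} (h : Spells S n x) : wordLength S x ≤ n :=
  Nat.sInf_le h

theorem wordLength_letter_le {a : G} (ha : a ∈ S) : wordLength S a ≤ 1 :=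
  wordLength_le ⟨[a], by simp [ha], rfl, by simp⟩

theorem Spells.mul {m n : ℕ} {x y : G} (hx : Spells S m x) (hy : Spells S n y) :
    Spells S (m + n) (x * y) := by
  obtain ⟨u, hu, rfl, rfl⟩ := hx
  obtain ⟨v, hv, rfl, rfl⟩ := hy
  exact ⟨u ++ v, fun a ha => (List.mem_append.1 ha).elim (hu a) (hv a), by simp, by simp⟩

theorem Spells.inv {n : ℕ} {x : G} (hx : Spells S n x) : Spells S n x⁻¹ := by
  obtain ⟨u, hu, rfl, rfl⟩ := hx
  refine ⟨(u.map (·⁻¹)).reverse, ?_, by simp, (List.prod_inv_reverse u).symm⟩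
  intro a ha
  obtain ⟨b, hb, rfl⟩ := List.mem_map.1 (List.mem_reverse.1 ha)
  simpa using (hu b hb).symm

/-- A group with generating set `S`, closed under inverses, in whose Cayley graph geodesics are
unique, and such that the geodesics from the identity to two adjacent vertices at the same distance
agree except for their last `r` edges. -/
structure IsGeodetic (S : Set G) (r : ℕ) : Prop where
  inv_mem : ∀ a ∈ S, a⁻¹ ∈ S
  exists_spells : ∀ x, ∃ n, Spells S n x
  unique : ∀ x y z, wordLength S y + wordLength S (y⁻¹ * x) = wordLength S x →
    wordLength S z + wordLength S (z⁻¹ * x) = wordLength S x →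
    wordLength S y = wordLength S z → y = z
  diverge : ∀ x, ∀ a ∈ S, wordLength S (x * a) = wordLength S x →
    ∃ z, wordLength S z + wordLength S (z⁻¹ * x) = wordLength S x ∧
      wordLength S z + wordLength S (z⁻¹ * (x * a)) = wordLength S (x * a) ∧
      wordLength S x ≤ wordLength S z + r

/-- `z` lies on a geodesic from the identity to `x`. -/
def IsPrefix (S : Set G) (z x : G) : Prop :=
  wordLength S z + wordLength S (z⁻¹ * x) = wordLength S x

/-- The vertex at distance `i` from the identity on the geodesic to `x`. -/
noncomputable def geodesicPoint (S : Set G) (x : G) (i : ℕ) : G :=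
  Classical.epsilon fun z => IsPrefix S z x ∧ wordLength S z = i

namespace IsGeodetic

variable {r : ℕ}

theorem spells_wordLength (H : IsGeodetic S r) (x : G) : Spells S (wordLength S x) x :=
  Nat.sInf_mem (s := {n | Spells S n x}) (H.exists_spells x)

theorem wordLength_mul_le (H : IsGeodetic S r) (x y : G) :
    wordLength S (x * y) ≤ wordLength S x + wordLength S y :=
  wordLength_le ((H.spells_wordLength x).mul (H.spells_wordLength y))

theorem wordLength_inv (H : IsGeodetic S r) (x : G) : wordLength S x⁻¹ = wordLength S x :=
  le_antisymm (wordLength_le (H.spells_wordLength x).inv)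
    (wordLength_le (by simpa using (H.spells_wordLength x⁻¹).inv))

theorem wordLength_inv_mul (H : IsGeodetic S r) (x y : G) :
    wordLength S (x⁻¹ * y) = wordLength S (y⁻¹ * x) := by
  rw [← H.wordLength_inv]; simp

theorem eq_one_of_wordLength (H : IsGeodetic S r) {x : G} (h : wordLength S x = 0) : x = 1 := by
  obtain ⟨w, -, hw, rfl⟩ := H.spells_wordLength x
  rw [h, List.length_eq_zero_iff] at hw
  simp [hw]

theorem exists_prefix (H : IsGeodetic S r) {x : G} {i : ℕ} (hi : i ≤ wordLength S x) :
    ∃ z, IsPrefix S z x ∧ wordLength S z = i := by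
  obtain ⟨w, hw, hl, hx⟩ := H.spells_wordLength x
  have h₁ : wordLength S (w.take i).prod ≤ i :=
    wordLength_le ⟨w.take i, fun a ha => hw a (List.mem_of_mem_take ha), by simp; omega, rfl⟩
  have h₂ : wordLength S (w.drop i).prod ≤ wordLength S x - i :=
    wordLength_le ⟨w.drop i, fun a ha => hw a (List.mem_of_mem_drop ha), by simp; omega, rfl⟩
  have hxw : x = (w.take i).prod * (w.drop i).prod := by rw [List.prod_take_mul_prod_drop, hx]
  have h₃ := H.wordLength_mul_le (w.take i).prod (w.drop i).prod
  rw [← hxw] at h₃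
  have h₄ : (w.take i).prod⁻¹ * x = (w.drop i).prod := inv_mul_eq_iff_eq_mul.2 hxw
  refine ⟨(w.take i).prod, ?_, by omega⟩
  rw [IsPrefix, h₄]
  omega

theorem isPrefix_geodesicPoint (H : IsGeodetic S r) {x : G} {i : ℕ} (hi : i ≤ wordLength S x) :
    IsPrefix S (geodesicPoint S x i) x :=
  (Classical.epsilon_spec (H.exists_prefix hi)).1

theorem wordLength_geodesicPoint (H : IsGeodetic S r) {x : G} {i : ℕ} (hi : i ≤ wordLength S x) :
    wordLength S (geodesicPoint S x i) = i :=
  (Classical.epsilon_spec (H.exists_prefix hi)).2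

theorem eq_geodesicPoint (H : IsGeodetic S r) {x z : G} {i : ℕ} (h : IsPrefix S z x)
    (hi : wordLength S z = i) :
    z = geodesicPoint S x i := by
  have hle : i ≤ wordLength S x := by rw [IsPrefix] at h; omega
  exact H.unique x _ _ h (H.isPrefix_geodesicPoint hle)
    (by rw [hi, H.wordLength_geodesicPoint hle])

theorem isPrefix_trans (H : IsGeodetic S r) {x y z : G} (h : IsPrefix S x y) (h' : IsPrefix S y z) :
    IsPrefix S x z := by
  unfold IsPrefix at *
  have h₁ := H.wordLength_mul_le (x⁻¹ * y) (y⁻¹ * z)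
  have h₂ := H.wordLength_mul_le x (x⁻¹ * z)
  rw [show x⁻¹ * y * (y⁻¹ * z) = x⁻¹ * z by group] at h₁
  rw [mul_inv_cancel_left] at h₂
  omega

theorem geodesicPoint_eq_of_isPrefix (H : IsGeodetic S r) {z x : G} {i : ℕ} (h : IsPrefix S z x)
    (hi : i ≤ wordLength S z) : geodesicPoint S x i = geodesicPoint S z i :=
  (H.eq_geodesicPoint (H.isPrefix_trans (H.isPrefix_geodesicPoint hi) h)
    (H.wordLength_geodesicPoint hi)).symm

theorem wordLength_geodesicPoint_inv_mul (H : IsGeodetic S r) {x : G} {i j : ℕ} (hij : i ≤ j)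
    (hj : j ≤ wordLength S x) :
    wordLength S ((geodesicPoint S x i)⁻¹ * geodesicPoint S x j) = j - i := by
  have hj' := H.wordLength_geodesicPoint hj
  have h := H.geodesicPoint_eq_of_isPrefix (H.isPrefix_geodesicPoint hj) (hij.trans hj'.ge)
  have h₁ := H.isPrefix_geodesicPoint (hij.trans hj'.ge)
  rw [← h, IsPrefix, H.wordLength_geodesicPoint (hij.trans hj), hj'] at h₁
  omega

theorem wordLength_mul_letter_le (H : IsGeodetic S r) {x a : G} (ha : a ∈ S) :
    wordLength S (x * a) ≤ wordLength S x + 1 :=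
  (H.wordLength_mul_le x a).trans (Nat.add_le_add_left (wordLength_letter_le ha) _)

theorem le_wordLength_mul_letter (H : IsGeodetic S r) {x a : G} (ha : a ∈ S) :
    wordLength S x ≤ wordLength S (x * a) + 1 := by
  simpa using H.wordLength_mul_letter_le (x := x * a) (H.inv_mem a ha)

/-- Geodesics to the endpoints of an edge agree up to distance `r` from the nearer endpoint. -/
theorem geodesicPoint_mul_letter (H : IsGeodetic S r) {x a : G} (ha : a ∈ S) {i : ℕ}
    (h₁ : i + r ≤ wordLength S x) (h₂ : i + r ≤ wordLength S (x * a)) :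
    geodesicPoint S (x * a) i = geodesicPoint S x i := by
  have h₃ := H.wordLength_mul_letter_le (x := x) ha
  have h₄ := H.le_wordLength_mul_letter (x := x) ha
  have h₅ := wordLength_letter_le ha
  rcases lt_trichotomy (wordLength S (x * a)) (wordLength S x) with h | h | h
  · symm
    apply H.geodesicPoint_eq_of_isPrefix _ (by omega)
    have h₆ := H.wordLength_mul_le (x * a) ((x * a)⁻¹ * x)
    rw [mul_inv_cancel_left] at h₆
    have h₇ : (x * a)⁻¹ * x = a⁻¹ := by group
    rw [h₇, H.wordLength_inv] at h₆
    rw [IsPrefix, h₇, H.wordLength_inv]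
    omega
  · obtain ⟨z, hz, hz', hl⟩ := H.diverge x a ha h
    rw [H.geodesicPoint_eq_of_isPrefix hz (by omega), H.geodesicPoint_eq_of_isPrefix hz' (by omega)]
  · apply H.geodesicPoint_eq_of_isPrefix _ (by omega)
    have h₆ := H.wordLength_mul_le x a
    rw [IsPrefix, inv_mul_cancel_left]
    omega

/-- A path of `n` edges from `x` to `x * y` stays at distance at least `(|x| + |x * y| - n) / 2 ≥ i
+ r` from `1`, so no edge of it changes the `i`-th point. -/
theorem geodesicPoint_mul (H : IsGeodetic S r) {n : ℕ} {x y : G} (hy : Spells S n y) {i : ℕ}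
    (h : 2 * (i + r) + n ≤ wordLength S x + wordLength S (x * y)) :
    geodesicPoint S (x * y) i = geodesicPoint S x i := by
  obtain ⟨w, hw, rfl, rfl⟩ := hy
  induction w generalizing x with
  | nil => simp
  | cons a w ih =>
    have ha : a ∈ S := (hw a (by simp)).elim id fun h => by simpa using H.inv_mem _ h
    have hw' : ∀ b ∈ w, b ∈ S ∨ b⁻¹ ∈ S := fun b hb => hw b (by simp [hb])
    have h₃ := H.wordLength_mul_letter_le (x := x) ha
    have h₄ := H.le_wordLength_mul_letter (x := x) ha
    have h₅ := H.wordLength_mul_le (x * a) w.prod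
    have h₆ := wordLength_le ⟨w, hw', rfl, rfl⟩
    simp only [List.length_cons, List.prod_cons, ← mul_assoc] at h ⊢
    rw [ih (x := x * a) hw' (by omega), H.geodesicPoint_mul_letter ha (by omega) (by omega)]

theorem geodesicPoint_inv (H : IsGeodetic S r) {x : G} {i : ℕ} (hi : i ≤ wordLength S x) :
    geodesicPoint S x⁻¹ (wordLength S x - i) = x⁻¹ * geodesicPoint S x i := by
  have h := H.isPrefix_geodesicPoint hi
  have h' := H.wordLength_geodesicPoint hi
  have h'' : wordLength S (x⁻¹ * geodesicPoint S x i) = wordLength S x - i := by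
    rw [H.wordLength_inv_mul]
    rw [IsPrefix] at h
    omega
  refine (H.eq_geodesicPoint ?_ h'').symm
  rw [IsPrefix, h'', H.wordLength_inv_mul]
  simp [H.wordLength_inv, h']
  omega

/-- If `t * g = h * t` with `t` long compared with `g` and `h`, then the geodesics from `1` to `t`
and from `h` to `h * t` share a long segment. -/
theorem exists_overlap (H : IsGeodetic S r) {k M : ℕ} {t g h : G} (hgt : t * g = h * t)
    (hg : wordLength S g ≤ k)
    (hh : wordLength S h ≤ k) (hM : M + k + 2 * r + 1 ≤ wordLength S t) :
    ∃ i j : ℕ, i ≤ j + k ∧ j ≤ i + k ∧ i + M ≤ wordLength S t ∧ j + M ≤ wordLength S t ∧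
      ∀ m ≤ M, geodesicPoint S t (i + m) = h * geodesicPoint S t (j + m) := by
  obtain ⟨x, hx⟩ : ∃ x, x = t * g := ⟨_, rfl⟩
  rw [← hx] at hgt
  have hxt : wordLength S x ≤ wordLength S t + k :=
    hx ▸ (H.wordLength_mul_le t g).trans (Nat.add_le_add_left hg _)
  have htx : wordLength S t ≤ wordLength S x + k := by
    have := H.wordLength_mul_le x g⁻¹
    rw [H.wordLength_inv, show x * g⁻¹ = t by rw [hx, mul_inv_cancel_right]] at this
    omega
  -- The first bound makes the geodesics from `1` to `t` and to `x` agree at `i`; the second makes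
  -- those from `x` back to `1` and to `h` agree at distance `|x| - i` from `x`.
  have key : ∀ i, 2 * (i + r) + k ≤ wordLength S t + wordLength S x →
      wordLength S x + 2 * r + k ≤ wordLength S t + 2 * i →
      geodesicPoint S t i = h * geodesicPoint S t (i + wordLength S t - wordLength S x) := by
    intro i h₁ h₂
    have e₁ : geodesicPoint S x i = geodesicPoint S t i := by
      rw [hx] at h₁ ⊢
      exact H.geodesicPoint_mul (H.spells_wordLength g) (by omega)
    have hx' : x⁻¹ = t⁻¹ * h⁻¹ := by rw [hgt]; group
    have e₂ : geodesicPoint S x⁻¹ (wordLength S x - i)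
        = geodesicPoint S t⁻¹ (wordLength S x - i) := by
      have hi := H.spells_wordLength h⁻¹
      rw [H.wordLength_inv] at hi
      have := H.geodesicPoint_mul (x := t⁻¹) (i := wordLength S x - i) hi
      rw [← hx', H.wordLength_inv, H.wordLength_inv] at this
      exact this (by omega)
    have e₃ := H.geodesicPoint_inv (x := t) (i := i + wordLength S t - wordLength S x) (by omega)
    rw [show wordLength S t - (i + wordLength S t - wordLength S x) = wordLength S x - i by omega,
      ← e₂, H.geodesicPoint_inv (by omega), e₁, inv_mul_eq_iff_eq_mul] at e₃
    rw [e₃, ← mul_assoc, show x * t⁻¹ = h by rw [hgt, mul_inv_cancel_right]]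
  -- The least `i` allowed by the second bound of `key`; the `+ 1` rounds the half up.
  refine ⟨(wordLength S x + k + 2 * r + 1 - wordLength S t) / 2,
    (wordLength S x + k + 2 * r + 1 - wordLength S t) / 2 + wordLength S t - wordLength S x,
    by omega, by omega, by omega, by omega, fun m hm => ?_⟩
  rw [key _ (by omega) (by omega)]
  congr 2
  omega

end IsGeodetic
end WordLength
end Rewriting

/-! ### Axes, centralizers and the dichotomy. -/

namespace Rewriting

section Axis

variable {G : Type*} [Group G] {S : Set G}

/-- `A` is a bi-infinite geodesic on which `h` acts as the translation by `d`. -/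
structure IsAxis (S : Set G) (A : ℤ → G) (d : ℕ) (h : G) : Prop where
  translate : ∀ n, h * A n = A (n + d)
  geodesic : ∀ (n : ℤ) (m : ℕ), wordLength S ((A n)⁻¹ * A (n + m)) = m

namespace IsAxis

variable {A : ℤ → G} {d : ℕ} {h : G}

theorem zpow_translate (hA : IsAxis S A d h) (q n : ℤ) : h ^ q * A n = A (n + q * d) := by
  induction q with
  | zero => simp
  | succ q ih =>
    rw [zpow_add_one, (Commute.self_zpow h q).eq.symm, mul_assoc, ih, hA.translate]
    congr 1
    ring
  | pred q ih =>
    rw [zpow_sub_one, (Commute.zpow_self h (-q)).inv_right.eq, mul_assoc, ih,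
      inv_mul_eq_iff_eq_mul, hA.translate]
    congr 1
    ring

theorem injective (hA : IsAxis S A d h) : Function.Injective A := by
  have key : ∀ (n : ℤ) (m : ℕ), A n = A (n + m) → m = 0 := by
    intro n m h
    have h₁ := hA.geodesic n m
    have h₂ := hA.geodesic n 0
    rw [← h] at h₁
    rw [Nat.cast_zero, add_zero] at h₂
    exact h₁.symm.trans h₂
  intro a b hab
  rcases le_total a b with h | h
  · obtain ⟨m, rfl⟩ := Int.le.dest h
    simp [key _ _ hab]
  · obtain ⟨m, rfl⟩ := Int.le.dest h
    simp [key _ _ hab.symm]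

theorem not_isOfFinOrder (hA : IsAxis S A d h) (hd : 0 < d) : ¬ IsOfFinOrder h := by
  rw [isOfFinOrder_iff_pow_eq_one]
  rintro ⟨n, hn, h₁⟩
  have h₂ := hA.zpow_translate n 0
  rw [zpow_natCast, h₁, one_mul, zero_add] at h₂
  have := hA.injective h₂
  have : 0 < (n : ℤ) * d := by positivity
  omega

end IsAxis

namespace IsGeodetic

variable {r : ℕ}

theorem mem_of_wordLength_eq_one (H : IsGeodetic S r) {a : G} (ha : wordLength S a = 1) :
    a ∈ S := by
  obtain ⟨w, hw, hl, hx⟩ := H.spells_wordLength a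
  obtain ⟨b, rfl⟩ := List.length_eq_one_iff.1 (hl.trans ha)
  obtain rfl : b = a := by simpa using hx
  exact (hw b (by simp)).elim id fun h => by simpa using H.inv_mem _ h

/-- A path all of whose segments of length at most `max (r + 1) 2` are geodesic is geodesic. -/
theorem wordLength_eq_of_local (H : IsGeodetic S r) {A : ℤ → G} (hA : ∀ (i : ℤ)
    (m : ℕ), m ≤ r + 1 ∨ m ≤ 2 →
    wordLength S ((A i)⁻¹ * A (i + m)) = m) (i : ℤ) (n : ℕ) :
    wordLength S ((A i)⁻¹ * A (i + n)) = n := by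
  induction n using Nat.strong_induction_on generalizing i with
  | _ n ih =>
  by_cases hn : n ≤ r + 1 ∨ n ≤ 2
  · exact hA i n hn
  obtain ⟨n, rfl⟩ : ∃ p, n = p + 1 := ⟨n - 1, by omega⟩
  set x := (A i)⁻¹ * A (i + n) with hx
  set a := (A (i + n))⁻¹ * A (i + n + 1) with ha
  have hxl : wordLength S x = n := ih n (by omega) i
  have haS : a ∈ S := H.mem_of_wordLength_eq_one (by simpa using hA (i + n) 1 (by omega))
  have hxa : (A i)⁻¹ * A (i + (n + 1 : ℕ)) = x * a := by
    rw [hx, ha, mul_assoc, mul_inv_cancel_left]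
    push_cast
    rw [add_assoc]
  have hpre : ∀ m : ℕ, m ≤ n → IsPrefix S ((A i)⁻¹ * A (i + m)) x := by
    intro m hm
    have h := ih (n - m) (by omega) (i + m)
    rw [show i + (m : ℤ) + ((n - m : ℕ) : ℤ) = i + n by omega] at h
    rw [IsPrefix, hxl, ih m (by omega) i, hx,
      show ((A i)⁻¹ * A (i + m))⁻¹ * ((A i)⁻¹ * A (i + n)) = (A (i + m))⁻¹ * A (i + n) by group, h]
    omega
  have h₃ := H.wordLength_mul_letter_le (x := x) haS
  have h₄ := H.le_wordLength_mul_letter (x := x) haS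
  have hquot : ∀ m : ℕ, ((A i)⁻¹ * A (i + m))⁻¹ * (x * a) = (A (i + m))⁻¹ * A (i + n + 1) := by
    intro m
    rw [hx, ha]
    group
  rw [hxa]
  by_contra hne
  rcases (by omega : wordLength S (x * a) = n ∨ wordLength S (x * a) = n - 1) with h | h
  -- Equal lengths: the geodesic to `x * a` passes through the point of the path at `n - r`, leaving
  -- distance `r` for a local segment of length `r + 1`.
  · have e := H.geodesicPoint_mul_letter haS (x := x) (i := n - r) (by omega) (by omega)
    have h₅ := H.isPrefix_geodesicPoint (x := x * a) (i := n - r) (by omega)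
    rw [e, ← H.eq_geodesicPoint (hpre (n - r) (by omega)) (ih _ (by omega) i), IsPrefix, hquot,
      ih _ (by omega) i, h] at h₅
    have h₆ := hA (i + (n - r : ℕ)) (r + 1) (by omega)
    rw [show i + ((n - r : ℕ) : ℤ) + ((r + 1 : ℕ) : ℤ) = i + n + 1 by omega] at h₆
    omega
  -- Shorter: by uniqueness the path backtracks, contradicting geodesicity of its last two edges.
  · have h₅ : IsPrefix S (x * a) x := by
      rw [IsPrefix, show (x * a)⁻¹ * x = a⁻¹ by group, H.wordLength_inv]
      have h₆ := H.wordLength_mul_le (x * a) a⁻¹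
      rw [H.wordLength_inv, mul_inv_cancel_right] at h₆
      have := wordLength_letter_le haS
      omega
    have h₆ := H.unique x _ _ h₅ (hpre (n - 1) (by omega)) (by rw [h, ih _ (by omega) i])
    have h₇ := hquot (n - 1)
    rw [← h₆, inv_mul_cancel] at h₇
    have h₈ := hA (i + (n - 1 : ℕ)) 2 (by omega)
    have h₉ := hA i 0 (by omega)
    rw [show i + ((n - 1 : ℕ) : ℤ) + ((2 : ℕ) : ℤ) = i + n + 1 by omega, ← h₇] at h₈
    rw [Nat.cast_zero, add_zero, inv_mul_cancel] at h₉
    omega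

/-- The axis is tiled by the translates under powers of `h` of a stretch of length `d`. Every window
of length at most `M + 1` lies in a translate of the geodesic stretch of length `M + d`, so the line
is locally geodesic. -/
theorem exists_isAxis_of_overlap (H : IsGeodetic S r) {M i d : ℕ} {t h : G} (hd : 0 < d)
    (hr : r ≤ M) (hM : 1 ≤ M)
    (hlen : i + d + M ≤ wordLength S t)
    (ho : ∀ m ≤ M, h * geodesicPoint S t (i + m) = geodesicPoint S t (i + d + m)) :
    ∃ A, IsAxis S A d h := by
  set f : ℕ → G := fun n => geodesicPoint S t (i + n) with hf
  have ho' : ∀ m ≤ M, h * f m = f (m + d) := by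
    intro m hm
    simp only [hf, ho m hm]
    congr 1
    omega
  have hfold : ∀ n ≤ M + d, f n = h ^ (n / d) * f (n % d) := by
    intro n
    induction n using Nat.strong_induction_on with
    | _ n ih =>
    intro hn
    rcases lt_or_ge n d with h₁ | h₁
    · simp [Nat.div_eq_of_lt h₁, Nat.mod_eq_of_lt h₁]
    · rw [Nat.div_eq_sub_div hd h₁, Nat.mod_eq_sub_mod h₁, pow_succ', mul_assoc,
        ← ih (n - d) (by omega) (by omega), ho' _ (by omega), Nat.sub_add_cancel h₁]
  have hd' : (d : ℤ) ≠ 0 := by omega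
  set A : ℤ → G := fun n => h ^ (n / d) * f (n % d).toNat with hAdef
  have htr : ∀ q n : ℤ, A (n + q * d) = h ^ q * A n := by
    intro q n
    simp only [hAdef]
    rw [Int.add_mul_ediv_right _ _ hd', Int.add_mul_emod_self_right, add_comm, zpow_add, mul_assoc]
  have hAf : ∀ n : ℕ, n ≤ M + d → A n = f n := by
    intro n hn
    rw [hfold n hn]
    simp only [hAdef]
    norm_cast
  refine ⟨A, fun n => by simpa using (htr 1 n).symm, H.wordLength_eq_of_local ?_⟩
  intro n m hm
  have hs := Int.emod_nonneg n hd'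
  have hs' := Int.emod_lt_of_pos n (by omega : (0 : ℤ) < d)
  obtain ⟨s, hs₁⟩ := Int.eq_ofNat_of_zero_le hs
  have hn : n = s + n / d * d := by rw [← hs₁, Int.emod_add_ediv_mul]
  have e₁ : A n = h ^ (n / d) * f s := by
    rw [← hAf s (by omega), ← htr, ← hn]
  have e₂ : A (n + m) = h ^ (n / d) * f (s + m) := by
    rw [← hAf (s + m) (by omega), ← htr]
    congr 1
    push_cast
    linarith
  rw [e₁, e₂, mul_inv_rev, mul_assoc, inv_mul_cancel_left]
  simp only [hf]
  rw [H.wordLength_geodesicPoint_inv_mul (by omega) (by omega)]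
  omega

/-- If a long element conjugates `g` to `h ≠ 1`, then `h` has an axis. -/
theorem exists_isAxis (H : IsGeodetic S r) {k : ℕ} {t g h : G} (hgt : t * g = h * t)
    (hg : wordLength S g ≤ k)
    (hh : wordLength S h ≤ k) (h1 : h ≠ 1) (ht : 3 * r + 2 * k < wordLength S t) :
    ∃ A d h', 0 < d ∧ (h' = h ∨ h' = h⁻¹) ∧ IsAxis S A d h' := by
  have hk : 1 ≤ k := by
    by_contra hk
    exact h1 (H.eq_one_of_wordLength (by omega))
  -- With `M = r + k`, the requirement `M + k + 2 * r + 1 ≤ |t|` is exactly `ht`.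
  obtain ⟨i, j, -, -, hi, hj, ho⟩ := H.exists_overlap (M := r + k) hgt hg hh (by omega)
  rcases lt_trichotomy i j with hij | rfl | hij
  · obtain ⟨d, rfl⟩ := Nat.exists_eq_add_of_lt hij
    obtain ⟨A, hA⟩ := H.exists_isAxis_of_overlap (h := h⁻¹) (M := r + k) (i := i) (d := d + 1)
      (t := t) (by omega) (by omega) (by omega) (by omega) fun m hm => by
        rw [ho m hm, inv_mul_cancel_left, add_assoc i]
    exact ⟨A, _, _, by omega, Or.inr rfl, hA⟩
  · exact absurd (by simpa using ho 0 (by omega)) h1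
  · obtain ⟨d, rfl⟩ := Nat.exists_eq_add_of_lt hij
    obtain ⟨A, hA⟩ := H.exists_isAxis_of_overlap (h := h) (M := r + k) (i := j) (d := d + 1)
      (t := t) (by omega) (by omega) (by omega) (by omega) fun m hm => by
        rw [← ho m hm, add_assoc j]
    exact ⟨A, _, _, by omega, Or.inl rfl, hA⟩

/-- An element commuting with `h` translates the axis of `h`. -/
theorem exists_translate (H : IsGeodetic S r) {A : ℤ → G} {d : ℕ} {h s : G} (hA : IsAxis S A d h)
    (hd : 0 < d)
    (hs : Commute s h) : ∃ p : ℤ, ∀ n, s * A n = A (n + p) := by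
  set u := (A 0)⁻¹ * s * A 0 with hu
  -- Makes `|t| = N * d` long enough for an overlap of length `d`, a full period, between the
  -- geodesic to `t` and its translate by `u`.
  set N := d + wordLength S u + 2 * r + 1 with hN
  set t := (A 0)⁻¹ * A (N * d : ℕ) with ht
  have htl : wordLength S t = N * d := by
    simpa only [zero_add] using hA.geodesic 0 (N * d)
  have hNd : N ≤ N * d := Nat.le_mul_of_pos_right _ hd
  have htN : t = (A 0)⁻¹ * h ^ (N : ℤ) * A 0 := by
    rw [ht, mul_assoc, hA.zpow_translate]
    simp
  have hp : ∀ m ≤ wordLength S t, geodesicPoint S t m = (A 0)⁻¹ * A m := by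
    intro m hm
    have hm' : wordLength S ((A 0)⁻¹ * A m) = m := by simpa using hA.geodesic 0 m
    refine (H.eq_geodesicPoint ?_ hm').symm
    have h₁ := hA.geodesic m (N * d - m)
    rw [show (m : ℤ) + ((N * d - m : ℕ) : ℤ) = (N * d : ℕ) by omega] at h₁
    rw [IsPrefix, hm', ht, show ((A 0)⁻¹ * A m)⁻¹ * ((A 0)⁻¹ * A (N * d : ℕ))
      = (A m)⁻¹ * A (N * d : ℕ) by group, ← ht, htl, h₁]
    omega
  have hcomm : t * u = u * t := by
    have h₁ := (hs.zpow_right (N : ℤ)).eq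
    calc t * u = (A 0)⁻¹ * (h ^ (N : ℤ) * s) * A 0 := by rw [htN, hu]; group
      _ = (A 0)⁻¹ * (s * h ^ (N : ℤ)) * A 0 := by rw [h₁]
      _ = u * t := by rw [htN, hu]; group
  obtain ⟨i, j, -, -, hi, hj, ho⟩ := H.exists_overlap (M := d) hcomm le_rfl le_rfl (by omega)
  have key : ∀ m : ℕ, m ≤ d → s * A (j + m : ℕ) = A (i + m : ℕ) := by
    intro m hm
    have h₁ := ho m hm
    rw [hp _ (by omega), hp _ (by omega), hu] at h₁
    have h₂ : A (i + m : ℕ) = A 0 * ((A 0)⁻¹ * s * A 0 * ((A 0)⁻¹ * A (j + m : ℕ))) := by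
      rw [← h₁, mul_inv_cancel_left]
    rw [h₂]
    group
  -- `s` shifts one period of the axis by `i - j`; commuting with `h`, it shifts every period alike.
  refine ⟨i - j, fun n => ?_⟩
  have hd' : (d : ℤ) ≠ 0 := by omega
  have h₁ := Int.emod_nonneg (n - j) hd'
  have h₂ := Int.emod_lt_of_pos (n - j) (by omega : (0 : ℤ) < d)
  obtain ⟨m, hm⟩ := Int.eq_ofNat_of_zero_le h₁
  have h₃ : n - j = m + (n - j) / d * d := by rw [← hm, Int.emod_add_ediv_mul]
  have e₁ : A n = h ^ ((n - j) / d) * A (j + m : ℕ) := by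
    rw [hA.zpow_translate]
    congr 1
    push_cast
    linarith
  have e₂ : A (n + (i - j)) = h ^ ((n - j) / d) * A (i + m : ℕ) := by
    rw [hA.zpow_translate]
    congr 1
    push_cast
    linarith
  rw [e₁, e₂, ← mul_assoc, (hs.zpow_right _).eq, mul_assoc, key m (by omega)]

/-- The translation amount is an injective homomorphism to `ℤ`, since an element is determined by
its effect on `A 0`. The image is infinite because of the powers of `h`. -/
theorem nonempty_centralizer_mulEquiv (H : IsGeodetic S r) {A : ℤ → G} {d : ℕ} {h : G}
    (hA : IsAxis S A d h)
    (hd : 0 < d) : Nonempty (Subgroup.centralizer {h} ≃* Multiplicative ℤ) := by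
  have hc : ∀ s : Subgroup.centralizer {h}, Commute (s : G) h := fun s =>
    (Subgroup.mem_centralizer_singleton_iff.1 s.2)
  choose p hp using fun s : Subgroup.centralizer {h} => H.exists_translate hA hd (hc s)
  let φ : Subgroup.centralizer {h} →* Multiplicative ℤ := MonoidHom.mk'
    (fun s => Multiplicative.ofAdd (p s)) (by
      intro a b
      rw [← ofAdd_add]
      congr 1
      have h₁ : A (0 + p (a * b)) = A (0 + p b + p a) := by
        rw [← hp, ← hp, ← hp, Subgroup.coe_mul, mul_assoc]
      have := hA.injective h₁
      omega)
  have hφ : Function.Injective φ := by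
    intro a b hab
    have h₁ : p a = p b := Multiplicative.ofAdd.injective hab
    have h₂ : (a : G) * A 0 = b * A 0 := by rw [hp, hp, h₁]
    exact Subtype.ext (mul_right_cancel h₂)
  have : IsCyclic (Subgroup.centralizer {h}) := isCyclic_of_injective φ hφ
  have : Infinite (Subgroup.centralizer {h}) := by
    refine Infinite.of_injective (fun n : ℕ =>
      (⟨h, Subgroup.mem_centralizer_singleton_iff.2 rfl⟩ : Subgroup.centralizer {h}) ^ n) ?_
    intro m n hmn
    exact injective_pow_iff_not_isOfFinOrder.2 (hA.not_isOfFinOrder hd)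
      (by simpa using congrArg Subtype.val hmn)
  exact ⟨intCyclicMulEquiv.symm⟩

theorem finite_wordLength_le (H : IsGeodetic S r) (hS : S.Finite) (n : ℕ) :
    {x | wordLength S x ≤ n}.Finite := by
  induction n with
  | zero =>
    refine (Set.finite_singleton 1).subset fun x hx => H.eq_one_of_wordLength ?_
    exact Nat.le_zero.1 hx
  | succ n ih =>
    refine (ih.union (ih.mul hS)).subset fun x hx => ?_
    rcases Nat.lt_or_ge n (wordLength S x) with h | h
    · obtain ⟨z, hz, hz'⟩ := H.exists_prefix h.le
      have hx' : wordLength S x ≤ n + 1 := hx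
      rw [IsPrefix] at hz
      exact Or.inr ⟨z, hz'.le, z⁻¹ * x, H.mem_of_wordLength_eq_one (by omega), by simp⟩
    · exact Or.inl h

/-- The conjugating elements of bounded length characterise elements of infinite order. -/
theorem conjugator_dichotomy (H : IsGeodetic S r) (hS : S.Finite) {k : ℕ} {g h : G}
    (hg : wordLength S g ≤ k)
    (hh : wordLength S h ≤ k) (g1 : g ≠ 1) (h1 : h ≠ 1) (hgh : IsConj g h) :
    (IsOfFinOrder g → ∀ t : G, t * g * t⁻¹ = h → wordLength S t ≤ 3 * r + 2 * k) ∧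
    List.TFAE [∃ t : G, t * g * t⁻¹ = h ∧ 3 * r + 2 * k < wordLength S t,
      ¬ IsOfFinOrder g,
      Nonempty (Subgroup.centralizer {g} ≃* Multiplicative ℤ),
      Infinite (Subgroup.centralizer {g})] := by
  have h12 : (∃ t : G, t * g * t⁻¹ = h ∧ 3 * r + 2 * k < wordLength S t) → ¬ IsOfFinOrder g := by
    rintro ⟨t, ht, hl⟩ hfin
    obtain ⟨A, d, h', hd, hh', hA⟩ :=
      H.exists_isAxis (mul_inv_eq_iff_eq_mul.1 ht) hg hh h1 hl
    have hfin' := hgh.isOfFinOrder hfin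
    rcases hh' with rfl | rfl
    · exact hA.not_isOfFinOrder hd hfin'
    · exact hA.not_isOfFinOrder hd hfin'.inv
  refine ⟨fun hfin t ht => not_lt.1 fun hl => h12 ⟨t, ht, hl⟩ hfin, ?_⟩
  tfae_have 1 → 2 := h12
  tfae_have 2 → 3 := by
    intro hinf
    obtain ⟨_, ⟨n, rfl⟩, hn⟩ := (Set.infinite_range_of_injective
      (injective_pow_iff_not_isOfFinOrder.2 hinf)).exists_notMem_finite
      (H.finite_wordLength_le hS (3 * r + 2 * k))
    -- A long power of `g` conjugates `g` to itself, so `g` or `g⁻¹` has an axis.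
    obtain ⟨A, d, h', hd, hh', hA⟩ := H.exists_isAxis (t := g ^ n) (pow_mul_comm' g n) hg hg g1
      (not_le.1 hn)
    obtain ⟨E⟩ := H.nonempty_centralizer_mulEquiv hA hd
    have hc : Subgroup.centralizer {h'} = Subgroup.centralizer {g} := by
      rcases hh' with rfl | rfl
      · rfl
      · ext s
        simp only [Subgroup.mem_centralizer_singleton_iff]
        exact Commute.inv_right_iff
    exact ⟨(MulEquiv.subgroupCongr hc).symm.trans E⟩
  tfae_have 3 → 4 := by
    rintro ⟨E⟩
    exact Infinite.of_injective E.symm E.symm.injective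
  tfae_have 4 → 1 := by
    intro hinf
    obtain ⟨t, ht⟩ := isConj_iff.1 hgh
    -- The coset `t * C(g)` consists of conjugators and is infinite, so it leaves every ball.
    obtain ⟨_, ⟨s, rfl⟩, hs⟩ := (Set.infinite_range_of_injective
      (f := fun s : Subgroup.centralizer {g} => t * (s : G))
      fun a b hab => Subtype.ext (mul_left_cancel hab)).exists_notMem_finite
      (H.finite_wordLength_le hS (3 * r + 2 * k))
    refine ⟨t * s, ?_, not_le.1 hs⟩
    have h₁ : (s : G) * g = g * s := Subgroup.mem_centralizer_singleton_iff.1 s.2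
    rw [mul_assoc t, h₁, ← ht]
    group
  tfae_finish

end IsGeodetic
end Axis
end Rewriting

/-! ### From rewriting systems to geodetic groups. -/

namespace Rewriting

section Presentation

variable {α G : Type*} [Group G] {T : Finset (FreeMonoid α × FreeMonoid α)}

/-- The value in `G` of a word. -/
def value (e : PresentedBy T ≃* G) (w : FreeMonoid α) : G :=
  e ((thueCon T).mk' w)

variable (e : PresentedBy T ≃* G)

theorem value_mul (u v : FreeMonoid α) : value e (u * v) = value e u * value e v := by
  simp [value]

theorem value_one : value e 1 = 1 := by
  simp [value]

theorem value_eq_iff {u v : FreeMonoid α} :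
    value e u = value e v ↔ Relation.EqvGen (Step T) u v := by
  rw [value, value, e.injective.eq_iff]
  exact Con.eq _

theorem Step.value_eq {u v : FreeMonoid α} (h : Step T u v) : value e u = value e v :=
  (value_eq_iff e).2 (.rel _ _ h)

theorem Reduces.value_eq {u v : FreeMonoid α} (h : Reduces T u v) : value e u = value e v := by
  induction h with
  | refl => rfl
  | tail _ h ih => exact ih.trans (h.value_eq e)

theorem IsConfluent.joinable (hT : IsConfluent T) {u v : FreeMonoid α}
    (h : Relation.EqvGen (Step T) u v) : ∃ w, Reduces T u w ∧ Reduces T v w := by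
  induction h with
  | rel u v h => exact ⟨v, .single h, .refl⟩
  | refl u => exact ⟨u, .refl, .refl⟩
  | symm u v _ ih =>
    obtain ⟨w, h₁, h₂⟩ := ih
    exact ⟨w, h₂, h₁⟩
  | trans u v w _ _ ih₁ ih₂ =>
    obtain ⟨x, h₁, h₂⟩ := ih₁
    obtain ⟨y, h₃, h₄⟩ := ih₂
    obtain ⟨z, h₅, h₆⟩ := hT v x y h₂ h₃
    exact ⟨z, h₁.trans h₅, h₄.trans h₆⟩

theorem eq_of_irreducible (hconf : IsConfluent T) {u v : FreeMonoid α} (h : value e u = value e v)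
    (hu : ∀ w, ¬ Step T u w) (hv : ∀ w, ¬ Step T v w) : u = v := by
  obtain ⟨w, h₁, h₂⟩ := hconf.joinable ((value_eq_iff e).1 h)
  rcases h₁.cases_head with rfl | ⟨x, hx, -⟩
  · rcases h₂.cases_head with rfl | ⟨x, hx, -⟩
    · rfl
    · exact absurd hx (hv x)
  · exact absurd hx (hu x)

theorem Step.length_lt (hT : IsLengthReducing T) {u v : FreeMonoid α} (h : Step T u v) :
    v.length < u.length := by
  obtain ⟨x, l, r, y, hlr, rfl, rfl⟩ := h
  have := hT _ hlr
  simp only [FreeMonoid.length_mul] at *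
  omega

theorem eq_one_or_eq_mul_of (w : FreeMonoid α) : w = 1 ∨ ∃ v a, w = v * FreeMonoid.of a :=
  (List.eq_nil_or_concat w.toList).imp id fun ⟨v, a, h⟩ => 
    ⟨FreeMonoid.ofList v, a, h.trans List.concat_eq_append⟩

theorem mul_of_inj {u v : FreeMonoid α} {a b : α}
    (h : u * FreeMonoid.of a = v * FreeMonoid.of b) : u = v ∧ a = b :=
  List.append_singleton_inj.1 h

theorem inv_mem_letters (hinv : IsInverseClosed T) {a : G} (ha : a ∈ letters e) :
    a⁻¹ ∈ letters e := by
  obtain ⟨a, rfl⟩ := ha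
  obtain ⟨b, hb⟩ := hinv a
  have h := hb.value_eq e
  rw [value_mul, value_one] at h
  exact ⟨b, (inv_eq_of_mul_eq_one_right h).symm⟩

/-- Each inverse of a letter is itself a letter in `G`, so allowing inverses does not shorten words.
-/
theorem spells_iff (hinv : IsInverseClosed T) {n : ℕ} {x : G} :
    Spells (letters e) n x ↔ ∃ w : FreeMonoid α, w.length = n ∧ value e w = x := by
  constructor
  · rintro ⟨w, hw, rfl, rfl⟩
    induction w with
    | nil => exact ⟨1, by simp, value_one e⟩
    | cons a w ih =>
      obtain ⟨u, hu, hu'⟩ := ih fun b hb => hw b (by simp [hb])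
      have ha : a ∈ letters e := (hw a (by simp)).elim id fun h => by
        simpa using inv_mem_letters e hinv h
      obtain ⟨c, hc⟩ := ha
      refine ⟨FreeMonoid.of c * u, ?_, ?_⟩
      · simp [hu, add_comm]
      · rw [value_mul, hu', List.prod_cons, ← hc, value]
  · rintro ⟨w, rfl, rfl⟩
    refine ⟨w.toList.map fun a => value e (FreeMonoid.of a), ?_, by simp [FreeMonoid.length], ?_⟩
    · intro a ha
      obtain ⟨b, -, rfl⟩ := List.mem_map.1 ha
      exact Or.inl ⟨b, rfl⟩
    · induction w using FreeMonoid.recOn with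
      | one => simp [value_one]
      | of_mul a w ih => simp [value_mul, ← ih]

theorem wordLength_value_le (hinv : IsInverseClosed T) (w : FreeMonoid α) :
    wordLength (letters e) (value e w) ≤ w.length :=
  wordLength_le ((spells_iff e hinv).2 ⟨w, rfl, rfl⟩)

theorem exists_value_eq (hinv : IsInverseClosed T) (x : G) :
    ∃ w : FreeMonoid α, w.length = wordLength (letters e) x ∧ value e w = x :=
  (spells_iff e hinv).1 (Nat.sInf_mem (s := {n | Spells (letters e) n x}) (exists_spells e x))

theorem wordLength_value_mul_le (hinv : IsInverseClosed T) (x y : G) :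
    wordLength (letters e) (x * y) ≤
    wordLength (letters e) x + wordLength (letters e) y := by
  obtain ⟨u, hu, rfl⟩ := exists_value_eq e hinv x
  obtain ⟨v, hv, rfl⟩ := exists_value_eq e hinv y
  rw [← hu, ← hv, ← FreeMonoid.length_mul, ← value_mul]
  exact wordLength_value_le e hinv _

theorem not_step_of_length_eq (hinv : IsInverseClosed T) (hlen : IsLengthReducing T)
    {u v : FreeMonoid α}
    (hu : u.length = wordLength (letters e) (value e u)) : ¬ Step T u v := by
  intro h
  have h₁ := h.length_lt hlen
  have h₂ := wordLength_value_le e hinv v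
  rw [← h.value_eq e] at h₂
  omega

/-- In a group presented by an inverse-closed length-reducing confluent rewriting system,
every element has a unique irreducible word, which is its unique geodesic. -/
theorem isGeodetic_letters (hinv : IsInverseClosed T) (hlen : IsLengthReducing T)
    (hconf : IsConfluent T) : IsGeodetic (letters e) (maxRhs T) where
  inv_mem _ ha := inv_mem_letters e hinv ha
  exists_spells := exists_spells e
  unique x y z hy hz hyz := by
    obtain ⟨u, hu, rfl⟩ := exists_value_eq e hinv y
    obtain ⟨v, hv, rfl⟩ := exists_value_eq e hinv z
    obtain ⟨u', hu', hu''⟩ := exists_value_eq e hinv ((value e u)⁻¹ * x)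
    obtain ⟨v', hv', hv''⟩ := exists_value_eq e hinv ((value e v)⁻¹ * x)
    have e₁ : value e (u * u') = x := by rw [value_mul, hu'']; simp
    have e₂ : value e (v * v') = x := by rw [value_mul, hv'']; simp
    have h : u * u' = v * v' := by
      refine eq_of_irreducible e hconf (e₁.trans e₂.symm) ?_ ?_
      · exact fun w => not_step_of_length_eq e hinv hlen (by
          rw [e₁, FreeMonoid.length_mul, hu, hu', hy])
      · exact fun w => not_step_of_length_eq e hinv hlen (by
          rw [e₂, FreeMonoid.length_mul, hv, hv', hz])
    have h' : u = v := (List.append_inj (s₁ := u.toList) (s₂ := v.toList) h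
      (hu.trans (hyz.trans hv.symm))).1
    rw [h']
  diverge x a ha hxa := by
    obtain ⟨a, rfl⟩ := ha
    obtain ⟨u, hu, rfl⟩ := exists_value_eq e hinv x
    obtain ⟨w, hw, hw'⟩ := exists_value_eq e hinv (value e u * value e (FreeMonoid.of a))
    change wordLength _ (_ * value e (FreeMonoid.of a)) = _ at hxa
    change ∃ z, _ ∧ _ + wordLength _ (_ * (_ * value e (FreeMonoid.of a))) =
      wordLength _ (_ * value e (FreeMonoid.of a)) ∧ _
    rw [← value_mul] at hw hw' hxa
    -- If irreducible, this word of length `|x| + 1` would be the geodesic word of an element of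
    -- length `|x|`.
    obtain ⟨v, hv⟩ : ∃ v, Step T (u * FreeMonoid.of a) v := by
      by_contra! hirr
      have h := eq_of_irreducible e hconf hw'
        (fun v => not_step_of_length_eq e hinv hlen (by rw [hw', hw])) hirr
      rw [h, hxa, FreeMonoid.length_mul, FreeMonoid.length_of] at hw
      omega
    have hval := hv.value_eq e
    have hvl := wordLength_value_le e hinv v
    have hvl' := hv.length_lt hlen
    obtain ⟨p, l, r, q, hT, hl, rfl⟩ := hv
    have hrl : r.length < l.length := hlen _ hT
    have hr : r.length ≤ maxRhs T := Finset.le_sup (f := fun p => p.2.length) hT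
    -- A left-hand side missing the last letter would lie inside the irreducible word `u`.
    obtain rfl | ⟨q, b, rfl⟩ := eq_one_or_eq_mul_of q
    swap
    · rw [← mul_assoc] at hl
      have h : Step T u (p * r * q) := ⟨p, l, r, q, hT, (mul_of_inj hl).1, rfl⟩
      exact absurd h (not_step_of_length_eq e hinv hlen hu)
    obtain rfl | ⟨l, b, rfl⟩ := eq_one_or_eq_mul_of l
    · simp at hrl
    rw [mul_one, ← mul_assoc] at hl
    obtain ⟨rfl, rfl⟩ := mul_of_inj hl
    simp only [mul_one] at hval hvl hvl'
    rw [hval] at hxa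
    have h₁ := wordLength_value_le e hinv p
    have h₂ := wordLength_value_le e hinv l
    have h₃ := wordLength_value_le e hinv r
    have H₁ := wordLength_value_mul_le e hinv (value e p) (value e l)
    have H₂ := wordLength_value_mul_le e hinv (value e p) (value e r)
    rw [← value_mul] at H₁ H₂
    simp only [FreeMonoid.length_mul, FreeMonoid.length_of] at *
    -- Here `l` has lost its last letter and `u = p * l`. From `|x * a| ≤ |p| + |r| ≤ |p| + |l| =
    -- |x| = |x * a|`, the word `p * r` is geodesic too, so `p` is the common prefix.
    refine ⟨value e p, ?_, ?_, ?_⟩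
    · rw [value_mul, inv_mul_cancel_left, ← value_mul]
      omega
    · rw [← value_mul, hval, value_mul, inv_mul_cancel_left, ← value_mul]
      omega
    · omega

end Presentation
end Rewriting

theorem mainTheorem5 {α G : Type*} [Finite α] [Group G]
    (T : Finset (FreeMonoid α × FreeMonoid α))
    (hlen : Rewriting.IsLengthReducing T)
    (hconv : Rewriting.IsConvergent T)
    (hinv : Rewriting.IsInverseClosed T)
    (e : Rewriting.PresentedBy T ≃* G)
    (k : ℕ) (g h : G)
    (hg : g ∈ Rewriting.ball (Rewriting.letters e) k \ {1})
    (hh : h ∈ Rewriting.ball (Rewriting.letters e) k \ {1})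
    (hgh : IsConj g h) :
    (IsOfFinOrder g → ∀ t : G, t * g * t⁻¹ = h →
      Rewriting.wordLength (Rewriting.letters e) t ≤ 3 * Rewriting.maxRhs T + 2 * k) ∧
    List.TFAE [
      ∃ t : G, t * g * t⁻¹ = h ∧
        3 * Rewriting.maxRhs T + 2 * k < Rewriting.wordLength (Rewriting.letters e) t,
      ¬ IsOfFinOrder g,
      Nonempty (Subgroup.centralizer {g} ≃* Multiplicative ℤ),
      Infinite (Subgroup.centralizer {g})] := by
  have H := Rewriting.isGeodetic_letters e hinv hlen hconv.2
  have hball : ∀ x ∈ Rewriting.ball (Rewriting.letters e) k,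
      Rewriting.wordLength (Rewriting.letters e) x ≤ k := by
    rintro x ⟨n, hn, hx⟩
    exact (Rewriting.wordLength_le hx).trans hn
  exact H.conjugator_dichotomy (Set.finite_range _) (hball g hg.1) (hball h hh.1) hg.2 hh.2 hgh
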